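/- Let $X$ be a smooth manifold and let $\nabla$ be a smooth torsion-free connection on $T_X$, extended to endomorphism sections of $T_X$ by $(\nabla_\xi A)(V)=\nabla_\xi(AV)-A(\nabla_\xi V)$. For a smooth vector field $\xi$ let $L_\xi$ be the Lie derivative of endomorphism sections, $(L_\xi A)(V)=[\xi,AV]-A[\xi,V]$, let $\nabla\xi$ be the endomorphism section $v\mapsto\nabla_v\xi$, and for an endomorphism section $B$ let $\operatorname{ad}(B)A=[B,A]=BA-AB$. Write $[k]=\{1,\dots,k\}$ and let $\mathcal P_{k+1}$ be the set of set partitions of $[k+1]$. For $P\in\mathcal P_{k+1}$ let $p_{k+1}\in P$ be the block with maximum $k+1$, and put $P^*=P\smallsetminus\{p_{k+1}\}$; for $p\in P$ put $p^*=p\smallsetminus\{\max p\}$. For a family $(\xi_j)_{j=1}^k$ of vector fields and $S\subset[k]$ write $\nabla^S_{\xi_\bullet}=\prod_{j\in S}\nabla_{\xi_j}$ (composition of operators on endomorphism sections, the indices increasing from left to right; the empty product is the identity). Then for every $k\ge 0$ and every family $(\xi_j)_{j=1}^k$ of smooth vector fields on $X$, $$\prod_{j=1}^k L_{\xi_j}=\sum_{P\in\mathcal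 P_{k+1}}(-1)^{|P|-1}\Big[\prod_{p\in P^*}\operatorname{ad}\big(\nabla^{p^*}_{\xi_\bullet}\nabla\xi_{\max p}\big)\Big]\nabla^{p^*_{k+1}}_{\xi_\bullet}$$ as operators on the space of smooth endomorphism sections of $T_X$. The product on the left is taken in increasing order of $j$ from left to right, and the product over $P^*$ in increasing order of the maxima of the blocks, from left to right. -/

import Mathlib

open Bundle Set
open scoped Manifold ContDiff

noncomputable section

namespace MultLie

variable {E : Type*} [NormedAddCommGroup E] [NormedSpace ℝ E]
  {H : Type*} [TopologicalSpace H] (I : ModelWithCorners ℝ E H)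
  (M : Type*) [TopologicalSpace M] [ChartedSpace H M]

/-- Vector fields on `M` (no regularity imposed). -/
abbrev VField : Type _ := Π x : M, TangentSpace I x

/-- Sections of the endomorphism bundle `End(TM)` (no regularity imposed). -/
abbrev EndField : Type _ := Π x : M, TangentSpace I x →L[ℝ] TangentSpace I x

variable {I M}

/-- The vector field `A V`, obtained by applying `A` to `V` pointwise. -/
def EndField.app (A : EndField I M) (V : VField I M) : VField I M := fun x => A x (V x)

variable [IsManifold I ∞ M]

/-- `A` is differentiable at `x`, as a section of the bundle `End(TM)`. -/
def EndField.DiffAt (A : EndField I M) (x : M) : Prop :=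
  MDifferentiableAt I (I.prod 𝓘(ℝ, E →L[ℝ] E))
    (fun y => (⟨y, A y⟩ : TotalSpace (E →L[ℝ] E)
      (fun y : M => TangentSpace I y →L[ℝ] TangentSpace I y))) x

/-- `A` is a smooth section of the bundle `End(TM)`. -/
def EndField.Smooth (A : EndField I M) : Prop :=
  ContMDiff I (I.prod 𝓘(ℝ, E →L[ℝ] E)) ∞
    (fun y => (⟨y, A y⟩ : TotalSpace (E →L[ℝ] E)
      (fun y : M => TangentSpace I y →L[ℝ] TangentSpace I y)))

/-- `V` is a smooth vector field. -/
def VField.Smooth (V : VField I M) : Prop :=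
  ContMDiff I I.tangent ∞ (fun y => (⟨y, V y⟩ : TangentBundle I M))

/-- The adjoint operator `ad(B) A = [B, A] = B ∘ A - A ∘ B` on endomorphism fields. -/
def adEnd (B A : EndField I M) : EndField I M := fun x => (B x).comp (A x) - (A x).comp (B x)

theorem EndField.DiffAt.app {A : EndField I M} {x : M} (hA : EndField.DiffAt A x)
    {V : VField I M} (hV : MDiffAt (T% V) x) : MDiffAt (T% (EndField.app A V)) x :=
  MDifferentiableAt.clm_bundle_apply (F₁ := E) (F₂ := E)
    (E₁ := (TangentSpace I : M → Type _)) (E₂ := (TangentSpace I : M → Type _))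
    (b := fun y : M => y) hA hV

/-! ### Covariant derivative of endomorphism fields -/

/-- The expression `∇_ξ (A V) - A (∇_ξ V)` at the point `x`. -/
def covEndAux (cov : CovariantDerivative I E (TangentSpace I : M → Type _))
    (ξ : VField I M) (A : EndField I M) (x : M) (V : VField I M) : TangentSpace I x :=
  cov (EndField.app A V) x (ξ x) - A x (cov V x (ξ x))

theorem covEndAux_tensorial (cov : CovariantDerivative I E (TangentSpace I : M → Type _))
    (ξ : VField I M) {A : EndField I M} {x : M} (hA : EndField.DiffAt A x) :
    TensorialAt I E (covEndAux cov ξ A x) x where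
  smul {f V} hf hV := by
    have h : EndField.app A (f • V) = f • EndField.app A V := by
      funext y; simp [EndField.app]
    simp only [covEndAux, h]
    rw [cov.isCovariantDerivativeOnUniv.leibniz (hA.app hV) hf,
      cov.isCovariantDerivativeOnUniv.leibniz hV hf]
    simp [EndField.app, smul_sub]
  add {V W} hV hW := by
    have h : EndField.app A (V + W) = EndField.app A V + EndField.app A W := by
      funext y; simp [EndField.app]
    simp only [covEndAux, h]
    rw [cov.isCovariantDerivativeOnUniv.add (hA.app hV) (hA.app hW),
      cov.isCovariantDerivativeOnUniv.add hV hW]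
    simp only [add_apply, map_add]
    abel

/-! ### Lie derivative of endomorphism fields -/

/-- The expression `[ξ, A V] - A [ξ, V]` at the point `x`. -/
def lieEndAux (ξ : VField I M) (A : EndField I M) (x : M) (V : VField I M) : TangentSpace I x :=
  VectorField.mlieBracket I ξ (EndField.app A V) x - A x (VectorField.mlieBracket I ξ V x)

theorem lieEndAux_tensorial [CompleteSpace E]
    (ξ : VField I M) {A : EndField I M} {x : M} (hA : EndField.DiffAt A x) :
    TensorialAt I E (lieEndAux ξ A x) x where
  smul {f V} hf hV := by
    have h : EndField.app A (f • V) = f • EndField.app A V := by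
      funext y; simp [EndField.app]
    simp only [lieEndAux, h]
    rw [VectorField.mlieBracket_smul_right hf (hA.app hV),
      VectorField.mlieBracket_smul_right hf hV]
    simp [EndField.app, smul_sub]
  add {V W} hV hW := by
    have h : EndField.app A (V + W) = EndField.app A V + EndField.app A W := by
      funext y; simp [EndField.app]
    simp only [lieEndAux, h]
    rw [VectorField.mlieBracket_add_right (hA.app hV) (hA.app hW),
      VectorField.mlieBracket_add_right hV hW]
    simp only [map_add]
    abel

variable [FiniteDimensional ℝ E]

open Classical in
/-- The extension of a connection on `TM` to endomorphism fields: `(∇_ξ A)_x` is the endomorphism of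
`T_x M` with `(∇_ξ A) V = ∇_ξ (A V) - A (∇_ξ V)` for all vector fields `V` differentiable at `x`
(see `covEnd_apply`). At points where `A` is not differentiable the value is `0`. -/
def covEnd (cov : CovariantDerivative I E (TangentSpace I : M → Type _))
    (ξ : VField I M) (A : EndField I M) : EndField I M := fun x =>
  if hA : EndField.DiffAt A x then
    TensorialAt.mkHom (covEndAux cov ξ A x) x (covEndAux_tensorial cov ξ hA)
  else 0

theorem covEnd_apply (cov : CovariantDerivative I E (TangentSpace I : M → Type _))
    (ξ : VField I M) {A : EndField I M} {x : M} (hA : EndField.DiffAt A x)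
    {V : VField I M} (hV : MDiffAt (T% V) x) :
    covEnd cov ξ A x (V x) = cov (fun y => A y (V y)) x (ξ x) - A x (cov V x (ξ x)) := by
  simp only [covEnd, hA, dite_true]
  exact TensorialAt.mkHom_apply _ hV

open Classical in
/-- The Lie derivative of endomorphism fields: `(L_ξ A)_x` is the endomorphism of `T_x M` with
`(L_ξ A) V = [ξ, A V] - A [ξ, V]` for all vector fields `V` differentiable at `x`
(see `lieEnd_apply`). At points where `A` is not differentiable the value is `0`. -/
def lieEnd
    (ξ : VField I M) (A : EndField I M) : EndField I M := fun x =>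
  if hA : EndField.DiffAt A x then
    TensorialAt.mkHom (lieEndAux ξ A x) x (lieEndAux_tensorial ξ hA)
  else 0

theorem lieEnd_apply
    (ξ : VField I M) {A : EndField I M} {x : M} (hA : EndField.DiffAt A x)
    {V : VField I M} (hV : MDiffAt (T% V) x) :
    lieEnd ξ A x (V x) =
      VectorField.mlieBracket I ξ (fun y => A y (V y)) x
        - A x (VectorField.mlieBracket I ξ V x) := by
  simp only [lieEnd, hA, dite_true]
  exact TensorialAt.mkHom_apply _ hV

/-! ### Ordered products of operators and the partition formula -/

/-- The product (composition) `T_{j₁} T_{j₂} ⋯ T_{jₙ}` of operators, where `S = {j₁ < ⋯ < jₙ}`: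
the product over `S` taken in increasing order from the left to the right. -/
def opProd {α : Type*} (T : ℕ → α → α) (S : Finset ℕ) (a : α) : α :=
  (S.sort (· ≤ ·)).foldr (fun j b => T j b) a

/-- `∇_ξ^S = ∏_{j ∈ S} ∇_{ξ_j}`, acting on endomorphism fields. -/
def covProd (cov : CovariantDerivative I E (TangentSpace I : M → Type _))
    (ξ : ℕ → VField I M) (S : Finset ℕ) : EndField I M → EndField I M :=
  opProd (fun j => covEnd cov (ξ j)) S

/-- The maximum of a nonempty finite set of natural numbers. -/
def maxOf (p : Finset ℕ) : ℕ := p.sup id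

/-- `P* = P ∖ {p_{k+1}}`, where `p_{k+1}` is the block of `P` containing `k + 1`, which is the unique
block whose maximum is `k + 1`. -/
def starParts {k : ℕ} (P : Finpartition (Finset.Icc 1 (k + 1))) : Finset (Finset ℕ) :=
  P.parts.erase (P.part (k + 1))

/-- The summand of a set partition `P` of `{1, …, k + 1}`, without its sign, applied to `A`:
`[∏_{p ∈ P*} ad(∇_ξ^{p*} ∇ξ_{max p})] ∇_ξ^{p*_{k+1}} A`, with `p* = p ∖ {max p}`.
The blocks `p ∈ P*` have distinct maxima, so the product over `P*` in the order of the maxima is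
indexed by the set of these maxima: the block with maximum `m` is the block `P.part m`
containing `m`. Here `∇ξ_m` is the endomorphism field `cov (ξ m) : v ↦ ∇_v ξ_m`. -/
def partTerm (cov : CovariantDerivative I E (TangentSpace I : M → Type _))
    (ξ : ℕ → VField I M) {k : ℕ} (P : Finpartition (Finset.Icc 1 (k + 1)))
    (A : EndField I M) : EndField I M :=
  opProd (fun m => adEnd (covProd cov ξ ((P.part m).erase m) (cov (ξ m))))
    ((starParts P).image maxOf)
    (covProd cov ξ ((P.part (k + 1)).erase (k + 1)) A)

end MultLie

end

/-!
For a torsion-free connection `[ξ, V] = ∇_ξ V - ∇_V ξ`, and hence `L_ξ = ∇_ξ - ad(∇ξ)` on smooth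
endomorphism fields (`MultLie.lieEnd_eq_covEnd_sub_adEnd`). Moreover `∇_ξ` is a derivation of the
commutator: `∇_ξ ad(B) = ad(∇_ξ B) + ad(B) ∇_ξ` (`MultLie.covEnd_adEnd`). The formula follows from
these two facts alone, by induction on the set of indices, adding the smallest index `a` (the
leftmost factor) at each step. Consider the term `[∏_p ad(∇^{p*} ∇ξ_{max p})] ∇^{p_N*}` of a
partition `P`, where `N` is the largest point. By the product rule, `∇_{ξ_a}` maps it to the sum of
the terms of the partitions obtained by joining `a` to one of the blocks of `P`; since `a` is
smaller than all other points, `∇_{ξ_a}` lands at the left end of the product of that block and the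
maxima do not change (`MultLie.map_blockTerm`). The operator `-ad(∇ξ_a)` gives the term of `P`
together with the new block `{a}`, whose maximum `a` comes first, and the sign changes because there
is one more block (`MultLie.blockTerm_adjoin_empty`). Each partition of the larger set arises exactly
once in this way (`Finpartition.sum_insert_eq_sum_adjoin`).

The induction is carried out in a vector space with a bilinear product `ad`, derivations `D j` and
elements `X j` (`MultLie.opProd_sub_ad_eq_sum`). It is applied to the space of smooth endomorphism
fields. That this space is stable under `∇_ξ` and `ad` follows from the criterion
`MultLie.EndField.smooth_of_app`: an endomorphism field is smooth if it maps smooth vector fields to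
smooth vector fields, because every local frame extends to global smooth vector fields by means of a
bump function.
-/

/-! ### Set partitions of a set with one more element -/

namespace Finpartition

variable {α : Type*} [DecidableEq α] {a : α} {T : Finset α}

/-- The partition of `insert a T` obtained from a partition `P` of `T` by joining the new point `a`
to `q`, which is a block of `P` or the empty set; in the latter case `{a}` is a new block. -/
def adjoin (P : Finpartition T) (ha : a ∉ T) (q : Finset α) (hq : q ∈ insert ∅ P.parts) :
    Finpartition (insert a T) :=
  have key : ∀ p ∈ P.parts, a ∉ p := fun p hp h => ha (P.subset hp h)
  have hqT : q ⊆ T := by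
    rcases Finset.mem_insert.1 hq with rfl | h
    · simp
    · exact P.subset h
  ofExistsUnique (insert (insert a q) (P.parts.erase q))
    (by
      intro p hp
      rcases Finset.mem_insert.1 hp with rfl | h
      · exact Finset.insert_subset_insert _ hqT
      · exact (P.subset (Finset.mem_of_mem_erase h)).trans (Finset.subset_insert _ _))
    (by
      intro b hb
      by_cases hbq : b ∈ insert a q
      · refine ⟨insert a q, ⟨Finset.mem_insert_self _ _, hbq⟩, ?_⟩
        rintro t ⟨ht, hbt⟩
        rcases Finset.mem_insert.1 ht with rfl | h
        · rfl
        · obtain ⟨htq, htP⟩ := Finset.mem_erase.1 h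
          rcases Finset.mem_insert.1 hbq with rfl | hbq
          · exact absurd hbt (key t htP)
          · rcases Finset.mem_insert.1 hq with rfl | hqP
            · simp at hbq
            · exact absurd (P.eq_of_mem_parts htP hqP hbt hbq) htq
      · have hbT : b ∈ T := by
          rcases Finset.mem_insert.1 hb with rfl | h
          · simp at hbq
          · exact h
        refine ⟨P.part b, ⟨?_, P.mem_part hbT⟩, ?_⟩
        · refine Finset.mem_insert_of_mem (Finset.mem_erase.2 ⟨?_, P.part_mem.2 hbT⟩)
          rintro rfl
          exact hbq (Finset.mem_insert_of_mem (P.mem_part hbT))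
        · rintro t ⟨ht, hbt⟩
          rcases Finset.mem_insert.1 ht with rfl | h
          · exact absurd hbt hbq
          · exact (P.part_eq_of_mem (Finset.mem_of_mem_erase h) hbt).symm)
    (by
      intro h
      rcases Finset.mem_insert.1 h with h | h
      · exact Finset.insert_ne_empty _ _ h.symm
      · exact P.empty_notMem_parts (Finset.mem_of_mem_erase h))

variable {P : Finpartition T} {ha : a ∉ T} {q : Finset α} {hq : q ∈ insert ∅ P.parts}

theorem parts_adjoin : (P.adjoin ha q hq).parts = insert (insert a q) (P.parts.erase q) := rfl

theorem notMem_of_mem_insert_empty_parts (ha : a ∉ T) (hq : q ∈ insert ∅ P.parts) : a ∉ q := by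
  rcases Finset.mem_insert.1 hq with rfl | h
  · simp
  · exact fun h' => ha (P.subset h h')

theorem part_adjoin_self : (P.adjoin ha q hq).part a = insert a q :=
  part_eq_of_mem _ (by simp [parts_adjoin]) (Finset.mem_insert_self _ _)

theorem part_adjoin_of_mem {b : α} (hb : b ∈ q) : (P.adjoin ha q hq).part b = insert a q :=
  part_eq_of_mem _ (by simp [parts_adjoin]) (Finset.mem_insert_of_mem hb)

theorem part_adjoin_of_notMem {b : α} (hbT : b ∈ T) (hb : b ∉ q) :
    (P.adjoin ha q hq).part b = P.part b := by
  refine part_eq_of_mem _ ?_ (P.mem_part hbT)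
  rw [parts_adjoin]
  refine Finset.mem_insert_of_mem (Finset.mem_erase.2 ⟨?_, P.part_mem.2 hbT⟩)
  rintro rfl
  exact hb (P.mem_part hbT)

theorem insert_notMem_parts (ha : a ∉ T) (P : Finpartition T) (q r : Finset α) :
    insert a q ∉ P.parts.erase r := fun h =>
  ha (P.subset (Finset.mem_of_mem_erase h) (Finset.mem_insert_self _ _))

theorem card_parts_adjoin_empty (h : ∅ ∈ insert ∅ P.parts) :
    (P.adjoin ha ∅ h).parts.card = P.parts.card + 1 := by
  rw [parts_adjoin, Finset.card_insert_of_notMem (insert_notMem_parts ha P _ _),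
    Finset.erase_eq_of_notMem P.empty_notMem_parts]

theorem card_parts_adjoin_of_mem (hqP : q ∈ P.parts) :
    (P.adjoin ha q hq).parts.card = P.parts.card := by
  rw [parts_adjoin, Finset.card_insert_of_notMem (insert_notMem_parts ha P _ _),
    Finset.card_erase_add_one hqP]

/-- Deleting the point `a` from the blocks of `P.adjoin ha q hq` gives back the blocks of `P`. -/
theorem image_erase_parts_adjoin :
    ((P.adjoin ha q hq).parts.image (·.erase a)).erase ∅ = P.parts := by
  have haq := notMem_of_mem_insert_empty_parts ha hq
  have h1 : (P.parts.erase q).image (·.erase a) = P.parts.erase q := by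
    conv_rhs => rw [← Finset.image_id (s := P.parts.erase q)]
    refine Finset.image_congr fun p hp => ?_
    exact Finset.erase_eq_of_notMem fun h => ha (P.subset (Finset.mem_of_mem_erase hp) h)
  rw [parts_adjoin, Finset.image_insert, h1, Finset.erase_insert haq]
  rcases Finset.mem_insert.1 hq with rfl | h
  · rw [Finset.erase_eq_of_notMem P.empty_notMem_parts, Finset.erase_insert P.empty_notMem_parts]
  · rw [Finset.insert_erase h, Finset.erase_eq_of_notMem P.empty_notMem_parts]

/-- Every partition of `insert a T` arises by adjoining `a` to a partition of `T`. -/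
theorem exists_adjoin_eq (ha : a ∉ T) (Q : Finpartition (insert a T)) :
    ∃ (P : Finpartition T) (q : Finset α) (hq : q ∈ insert ∅ P.parts), P.adjoin ha q hq = Q := by
  -- `P` is the partition obtained by deleting `a` from its block, which is dropped if it was `{a}`.
  have haQ : Q.part a ∈ Q.parts := Q.part_mem.2 (Finset.mem_insert_self _ _)
  have haa : a ∈ Q.part a := Q.mem_part (Finset.mem_insert_self _ _)
  have hoth : ∀ p ∈ Q.parts, p ≠ Q.part a → a ∉ p := fun p hp hne h =>
    hne (Q.part_eq_of_mem hp h).symm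
  have hoff : ∀ p ∈ Q.parts, p ≠ Q.part a → p.erase a = p := fun p hp hne =>
    Finset.erase_eq_of_notMem (hoth p hp hne)
  have hex : ∀ p ∈ Q.parts, ∀ b ∈ p.erase a, p = Q.part b := fun p hp b hb =>
    (Q.part_eq_of_mem hp (Finset.mem_of_mem_erase hb)).symm
  let P : Finpartition T := ofExistsUnique ((Q.parts.image (·.erase a)).erase ∅)
    (by
      intro p hp
      obtain ⟨r, hr, rfl⟩ := Finset.mem_image.1 (Finset.mem_of_mem_erase hp)
      intro b hb
      have := Q.subset hr (Finset.mem_of_mem_erase hb)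
      exact (Finset.mem_insert.1 this).resolve_left (Finset.ne_of_mem_erase hb))
    (by
      intro b hb
      have hba : b ≠ a := fun h => ha (h ▸ hb)
      have hbI : b ∈ insert a T := Finset.mem_insert_of_mem hb
      have hbb : b ∈ (Q.part b).erase a := Finset.mem_erase.2 ⟨hba, Q.mem_part hbI⟩
      refine ⟨(Q.part b).erase a, ⟨Finset.mem_erase.2 ⟨Finset.ne_empty_of_mem hbb,
        Finset.mem_image_of_mem _ (Q.part_mem.2 hbI)⟩, hbb⟩, ?_⟩
      rintro t ⟨ht, hbt⟩
      obtain ⟨r, hr, rfl⟩ := Finset.mem_image.1 (Finset.mem_of_mem_erase ht)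
      exact congrArg (·.erase a) (hex r hr b hbt))
    (Finset.notMem_erase _ _)
  have hPparts : P.parts = (Q.parts.image (·.erase a)).erase ∅ := rfl
  have hq : (Q.part a).erase a ∈ insert ∅ P.parts := by
    rw [hPparts]
    by_cases h : (Q.part a).erase a = ∅
    · rw [h]; exact Finset.mem_insert_self _ _
    · exact Finset.mem_insert_of_mem
        (Finset.mem_erase.2 ⟨h, Finset.mem_image_of_mem _ haQ⟩)
  refine ⟨P, (Q.part a).erase a, hq, ?_⟩
  ext p
  rw [parts_adjoin, hPparts, Finset.insert_erase haa]
  simp only [Finset.mem_insert, Finset.mem_erase, Finset.mem_image]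
  constructor
  · rintro (rfl | ⟨h1, h2, r, hr, rfl⟩)
    · exact haQ
    · have : r ≠ Q.part a := fun h => h1 (by rw [h])
      rw [hoff r hr this]; exact hr
  · intro hp
    by_cases h : p = Q.part a
    · exact Or.inl h
    · refine Or.inr ⟨fun h' => ?_, Q.ne_empty hp, p, hp, hoff p hp h⟩
      obtain ⟨b, hb⟩ := Q.nonempty_of_mem_parts hp
      exact h ((hex _ haQ b (h' ▸ hb)).trans (Q.part_eq_of_mem hp hb) |>.symm)

/-- A sum over the partitions of `insert a T`, arranged by the partition of `T` that is left when
`a` is deleted. -/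
theorem sum_insert_eq_sum_adjoin {G : Type*} [AddCommMonoid G] (ha : a ∉ T)
    (f : Finpartition (insert a T) → G) :
    ∑ Q, f Q = ∑ P : Finpartition T, (f (P.adjoin ha ∅ (Finset.mem_insert_self _ _)) +
      ∑ q : P.parts, f (P.adjoin ha q (Finset.mem_insert_of_mem q.2))) := by
  let g (P : Finpartition T) (q : Finset α) : G :=
    if hq : q ∈ insert ∅ P.parts then f (P.adjoin ha q hq) else 0
  have hg : ∀ P q hq, g P q = f (adjoin P ha q hq) := fun P q hq => dif_pos hq
  -- The new block `{a}` is the case `q = ∅`, so both summands combine into one sum over `q`.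
  have hsum : ∀ P : Finpartition T, (f (P.adjoin ha ∅ (Finset.mem_insert_self _ _)) +
      ∑ q : P.parts, f (P.adjoin ha q (Finset.mem_insert_of_mem q.2))) =
      ∑ q ∈ insert ∅ P.parts, g P q := by
    intro P
    rw [Finset.sum_insert P.empty_notMem_parts, ← Finset.sum_coe_sort P.parts, hg]
    exact congrArg _ (Finset.sum_congr rfl fun q _ => (hg _ _ _).symm)
  simp_rw [hsum]
  rw [Finset.sum_sigma']
  symm
  refine Finset.sum_bij (fun x hx => x.1.adjoin ha x.2 (Finset.mem_sigma.1 hx).2)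
    (fun _ _ => Finset.mem_univ _) ?_ ?_ ?_
  · rintro ⟨P, q⟩ hx ⟨P', q'⟩ hx' h
    simp only [Finset.mem_sigma, Finset.mem_univ, true_and] at hx hx' h
    have hP : P = P' := by
      ext1
      rw [← image_erase_parts_adjoin (ha := ha) (hq := hx), h, image_erase_parts_adjoin]
    subst hP
    have hq : q = q' := by
      rw [← Finset.erase_insert (notMem_of_mem_insert_empty_parts ha hx),
        ← part_adjoin_self (ha := ha) (hq := hx), h, part_adjoin_self,
        Finset.erase_insert (notMem_of_mem_insert_empty_parts ha hx')]
    rw [hq]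
  · intro Q _
    obtain ⟨P, q, hq, h⟩ := exists_adjoin_eq ha Q
    exact ⟨⟨P, q⟩, Finset.mem_sigma.2 ⟨Finset.mem_univ _, hq⟩, h⟩
  · rintro ⟨P, q⟩ hx
    exact hg _ _ _

end Finpartition

noncomputable section

namespace MultLie

/-! ### Ordered products of operators -/

section OpProd

variable {α β : Type*}

@[simp]
theorem opProd_empty (T : ℕ → α → α) (x : α) : opProd T ∅ x = x := by simp [opProd]

theorem opProd_insert_of_lt (T : ℕ → α → α) {a : ℕ} {S : Finset ℕ} (h : ∀ b ∈ S, a < b) (x : α) :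
    opProd T (insert a S) x = T a (opProd T S x) := by
  rw [opProd, Finset.sort_insert _ (fun b hb => (h b hb).le) (fun ha => lt_irrefl a (h a ha))]
  rfl

theorem opProd_congr {T T' : ℕ → α → α} {S : Finset ℕ} (h : ∀ j ∈ S, T j = T' j) (x : α) :
    opProd T S x = opProd T' S x := by
  induction S using Finset.induction_on_min with
  | empty => simp
  | insert a S haS ih =>
    rw [opProd_insert_of_lt _ haS, opProd_insert_of_lt _ haS,
      ih fun j hj => h j (Finset.mem_insert_of_mem hj), h a (Finset.mem_insert_self _ _)]

theorem map_opProd (φ : α → β) {T : ℕ → α → α} {T' : ℕ → β → β}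
    {S : Finset ℕ} (h : ∀ j ∈ S, ∀ x, φ (T j x) = T' j (φ x)) (x : α) :
    φ (opProd T S x) = opProd T' S (φ x) := by
  induction S using Finset.induction_on_min with
  | empty => simp
  | insert a S haS ih =>
    rw [opProd_insert_of_lt _ haS, opProd_insert_of_lt _ haS, h a (Finset.mem_insert_self _ _),
      ih fun j hj => h j (Finset.mem_insert_of_mem hj)]

end OpProd

/-! ### Maxima of blocks -/

theorem maxOf_mem {p : Finset ℕ} (hp : p.Nonempty) : maxOf p ∈ p := by
  obtain ⟨b, hb, h⟩ := Finset.exists_mem_eq_sup p hp id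
  rw [maxOf, h]; exact hb

theorem le_maxOf {p : Finset ℕ} {b : ℕ} (hb : b ∈ p) : b ≤ maxOf p := Finset.le_sup (f := id) hb

theorem maxOf_insert_of_lt {p : Finset ℕ} (hp : p.Nonempty) {a : ℕ} (h : ∀ b ∈ p, a < b) :
    maxOf (insert a p) = maxOf p := by
  rw [maxOf, Finset.sup_insert]
  exact sup_eq_right.2 ((h _ (maxOf_mem hp)).le)

theorem maxOf_singleton (a : ℕ) : maxOf {a} = a := by simp [maxOf]

theorem part_maxOf {T : Finset ℕ} (P : Finpartition T) {p : Finset ℕ} (hp : p ∈ P.parts) :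
    P.part (maxOf p) = p :=
  P.part_eq_of_mem hp (maxOf_mem (P.nonempty_of_mem_parts hp))

/-- The maxima of the blocks of `P` other than the block containing `N`. -/
def starMax {T : Finset ℕ} (N : ℕ) (P : Finpartition T) : Finset ℕ :=
  (P.parts.erase (P.part N)).image maxOf

theorem starMax_subset {T : Finset ℕ} {N : ℕ} (P : Finpartition T) : starMax N P ⊆ T.erase N := by
  intro m hm
  obtain ⟨p, hp, rfl⟩ := Finset.mem_image.1 hm
  obtain ⟨h1, h2⟩ := Finset.mem_erase.1 hp
  have hm := maxOf_mem (P.nonempty_of_mem_parts h2)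
  refine Finset.mem_erase.2 ⟨?_, P.subset h2 hm⟩
  intro h
  exact h1 (by rw [← h, part_maxOf P h2])

section Adjoin

variable {T : Finset ℕ} {P : Finpartition T} {N a : ℕ} {ha : a ∉ T}

theorem starMax_adjoin_empty (hN : N ∈ T) (h : ∅ ∈ insert ∅ P.parts) :
    starMax N (P.adjoin ha ∅ h) = insert a (starMax N P) := by
  rw [starMax, starMax, Finpartition.part_adjoin_of_notMem hN (by simp), Finpartition.parts_adjoin,
    Finset.erase_eq_of_notMem P.empty_notMem_parts, Finset.erase_insert_of_ne,
    Finset.image_insert, insert_empty_eq, maxOf_singleton]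
  intro h
  exact ha (P.subset (P.part_mem.2 hN) (h ▸ Finset.mem_insert_self _ _))

theorem starMax_adjoin_of_mem (haT : ∀ b ∈ T, a < b) (hN : N ∈ T) {q : Finset ℕ}
    (hq : q ∈ P.parts) (hq' : q ∈ insert ∅ P.parts) :
    starMax N (P.adjoin ha q hq') = starMax N P := by
  have hmax : maxOf (insert a q) = maxOf q :=
    maxOf_insert_of_lt (P.nonempty_of_mem_parts hq) fun b hb => haT b (P.subset hq hb)
  by_cases hNq : N ∈ q
  · rw [starMax, starMax, Finpartition.part_adjoin_of_mem hNq, Finpartition.parts_adjoin,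
      Finset.erase_insert (Finpartition.insert_notMem_parts ha P _ _), P.part_eq_of_mem hq hNq]
  · have hne : q ≠ P.part N := fun h => hNq (h ▸ P.mem_part hN)
    rw [starMax, starMax, Finpartition.part_adjoin_of_notMem hN hNq, Finpartition.parts_adjoin,
      Finset.erase_insert_of_ne, Finset.image_insert, hmax, ← Finset.image_insert,
      Finset.erase_right_comm, Finset.insert_erase (Finset.mem_erase.2 ⟨hne, hq⟩)]
    intro h
    exact ha (P.subset (P.part_mem.2 hN) (h ▸ Finset.mem_insert_self _ _))

end Adjoin

/-! ### The partition formula for derivations of a bilinear product -/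

section Abstract

variable {G : Type*} [AddCommGroup G] [Module ℝ G]

/-- The product rule for a derivation `δ` of the bilinear product `ad`, applied to
`ad(B_{m₁}) ⋯ ad(B_{mₙ}) C`. -/
theorem derivation_opProd (ad : G →ₗ[ℝ] G →ₗ[ℝ] G) (δ : G →ₗ[ℝ] G)
    (hδ : ∀ B C, δ (ad B C) = ad (δ B) C + ad B (δ C)) (B : ℕ → G) (S : Finset ℕ) (C : G) :
    δ (opProd (fun m => ad (B m)) S C) =
      opProd (fun m => ad (B m)) S (δ C) +
        ∑ i ∈ S, opProd (fun m => ad (Function.update B i (δ (B i)) m)) S C := by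
  induction S using Finset.induction_on_min with
  | empty => simp
  | insert a S haS ih =>
    have haS' : a ∉ S := fun h => lt_irrefl a (haS a h)
    rw [opProd_insert_of_lt _ haS, hδ, ih, opProd_insert_of_lt _ haS, Finset.sum_insert haS',
      opProd_insert_of_lt _ haS, Function.update_self,
      opProd_congr (T := fun m => ad (Function.update B a (δ (B a)) m)) (T' := fun m => ad (B m))]
    · have hs : ∀ i ∈ S,
          opProd (fun m => ad (Function.update B i (δ (B i)) m)) (insert a S) C =
          ad (B a) (opProd (fun m => ad (Function.update B i (δ (B i)) m)) S C) := by
        intro i hi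
        rw [opProd_insert_of_lt _ haS, Function.update_of_ne (haS i hi).ne]
      rw [Finset.sum_congr rfl hs, map_add, map_sum]
      abel
    · intro j hj
      rw [Function.update_of_ne (haS j hj).ne']

variable (ad : G →ₗ[ℝ] G →ₗ[ℝ] G) (D : ℕ → G →ₗ[ℝ] G) (X : ℕ → G)

/-- The term of a partition `P` of a set with maximum `N`, applied to `A`:
`[∏_p ad(D^{p*} X_{max p})] D^{p_N*} A`, where `p_N` is the block of `N` and `p` runs over the other
blocks in the order of their maxima. As these maxima are distinct, the product is indexed by them,
and the block with maximum `m` is written `P.part m`. -/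
def blockTerm {T : Finset ℕ} (N : ℕ) (P : Finpartition T) (A : G) : G :=
  opProd (fun m => ad (opProd (fun j => D j) ((P.part m).erase m) (X m))) (starMax N P)
    (opProd (fun j => D j) ((P.part N).erase N) A)

variable {T : Finset ℕ} {P : Finpartition T} {N a : ℕ} {ha : a ∉ T}

theorem blockTerm_adjoin_empty (haT : ∀ b ∈ T, a < b) (hN : N ∈ T)
    (h : ∅ ∈ insert ∅ P.parts) (A : G) :
    blockTerm ad D X N (P.adjoin ha ∅ h) A = ad (X a) (blockTerm ad D X N P A) := by
  have hS : starMax N P ⊆ T := (starMax_subset P).trans (Finset.erase_subset _ _)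
  rw [blockTerm, starMax_adjoin_empty hN, opProd_insert_of_lt _ fun b hb => haT b (hS hb),
    Finpartition.part_adjoin_self, Finpartition.part_adjoin_of_notMem hN (by simp)]
  rw [Finset.erase_insert (by simp), opProd_empty, blockTerm]
  congr 1
  refine opProd_congr (fun m hm => ?_) _
  rw [Finpartition.part_adjoin_of_notMem (hS hm) (by simp)]

theorem opProd_erase_insert (haT : ∀ b ∈ T, a < b) {q : Finset ℕ} (hq : q ⊆ T) {m : ℕ}
    (hm : m ∈ q) (Y : G) :
    opProd (fun j => D j) ((insert a q).erase m) Y =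
      D a (opProd (fun j => D j) (q.erase m) Y) := by
  rw [Finset.erase_insert_of_ne (haT m (hq hm)).ne, opProd_insert_of_lt _ fun b hb =>
    haT b (hq (Finset.mem_of_mem_erase hb))]

theorem blockTerm_adjoin_part (haT : ∀ b ∈ T, a < b) (hN : N ∈ T)
    (h : P.part N ∈ insert ∅ P.parts) (A : G) :
    blockTerm ad D X N (P.adjoin ha (P.part N) h) A =
      opProd (fun m => ad (opProd (fun j => D j) ((P.part m).erase m) (X m))) (starMax N P)
        (D a (opProd (fun j => D j) ((P.part N).erase N) A)) := by
  have hNP := P.mem_part hN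
  rw [blockTerm, starMax_adjoin_of_mem haT hN (P.part_mem.2 hN),
    Finpartition.part_adjoin_of_mem hNP, opProd_erase_insert D haT (P.part_subset N) hNP]
  refine opProd_congr (fun m hm => ?_) _
  obtain ⟨p, hp, rfl⟩ := Finset.mem_image.1 hm
  obtain ⟨h1, h2⟩ := Finset.mem_erase.1 hp
  have hpm := maxOf_mem (P.nonempty_of_mem_parts h2)
  rw [Finpartition.part_adjoin_of_notMem (P.subset h2 hpm)]
  exact fun h => h1 (P.eq_of_mem_parts h2 (P.part_mem.2 hN) hpm h)

theorem blockTerm_adjoin_of_mem (haT : ∀ b ∈ T, a < b) (hN : N ∈ T) {q : Finset ℕ}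
    (hq : q ∈ P.parts.erase (P.part N)) (h : q ∈ insert ∅ P.parts) (A : G) :
    blockTerm ad D X N (P.adjoin ha q h) A =
      opProd (fun m => ad (Function.update
          (fun m => opProd (fun j => D j) ((P.part m).erase m) (X m)) (maxOf q)
          (D a (opProd (fun j => D j) ((P.part (maxOf q)).erase (maxOf q)) (X (maxOf q)))) m))
        (starMax N P) (opProd (fun j => D j) ((P.part N).erase N) A) := by
  obtain ⟨h1, h2⟩ := Finset.mem_erase.1 hq
  have hNq : N ∉ q := fun h => h1 (P.part_eq_of_mem h2 h).symm
  have hqm := maxOf_mem (P.nonempty_of_mem_parts h2)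
  rw [blockTerm, starMax_adjoin_of_mem haT hN h2, Finpartition.part_adjoin_of_notMem hN hNq]
  refine opProd_congr (fun m hm => ?_) _
  obtain ⟨p, hp, rfl⟩ := Finset.mem_image.1 hm
  have hpP := Finset.mem_of_mem_erase hp
  have hpm := maxOf_mem (P.nonempty_of_mem_parts hpP)
  by_cases hpq : p = q
  · subst hpq
    rw [Function.update_self, Finpartition.part_adjoin_of_mem hqm, part_maxOf P h2,
      opProd_erase_insert D haT (P.subset h2) hqm]
  · have hne : maxOf p ∉ q := fun h => hpq (P.eq_of_mem_parts hpP h2 hpm h)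
    rw [Function.update_of_ne fun h : maxOf p = maxOf q => hne (by rw [h]; exact hqm),
      Finpartition.part_adjoin_of_notMem (P.subset hpP hpm) hne]

/-- By the product rule, `D a` maps the term of `P` to the sum of the terms of the partitions
obtained by joining the new smallest point `a` to a block of `P`. -/
theorem map_blockTerm (hD : ∀ j B C, D j (ad B C) = ad (D j B) C + ad B (D j C))
    (haT : ∀ b ∈ T, a < b) (hN : N ∈ T) (A : G) :
    D a (blockTerm ad D X N P A) =
      ∑ q : P.parts, blockTerm ad D X N (P.adjoin ha q (Finset.mem_insert_of_mem q.2)) A := by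
  let B : ℕ → G := fun m => opProd (fun j => D j) ((P.part m).erase m) (X m)
  let C : G := opProd (fun j => D j) ((P.part N).erase N) A
  let g : Finset ℕ → G := fun q =>
    if q = P.part N then opProd (fun m => ad (B m)) (starMax N P) (D a C)
    else opProd (fun m => ad (Function.update B (maxOf q) (D a (B (maxOf q))) m)) (starMax N P) C
  have hg : ∀ q : P.parts,
      blockTerm ad D X N (P.adjoin ha q (Finset.mem_insert_of_mem q.2)) A = g q := by
    rintro ⟨q, hq⟩
    by_cases h : q = P.part N
    · subst h
      simp only [g, if_true]
      exact blockTerm_adjoin_part ad D X haT hN _ A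
    · simp only [g, if_neg h]
      exact blockTerm_adjoin_of_mem ad D X haT hN (Finset.mem_erase.2 ⟨h, hq⟩) _ A
  simp_rw [hg]
  rw [Finset.sum_coe_sort P.parts g, ← Finset.add_sum_erase _ _ (P.part_mem.2 hN), blockTerm,
    derivation_opProd ad (D a) (hD a) B, starMax, Finset.sum_image]
  · refine congrArg₂ _ (by simp only [g, if_true]; rfl) (Finset.sum_congr rfl fun q hq => ?_)
    simp only [g, if_neg (Finset.ne_of_mem_erase hq)]
    rfl
  · intro p hp q hq h
    rw [← part_maxOf P (Finset.mem_of_mem_erase hp), h, part_maxOf P (Finset.mem_of_mem_erase hq)]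

/-- The partition formula for a bilinear product `ad` with derivations `D j`. The induction adds the
smallest index `a`: in `D a - ad (X a)`, the operator `D a` joins `a` to one of the blocks, and
`-ad (X a)` creates the block `{a}`. -/
theorem opProd_sub_ad_eq_sum (hD : ∀ j B C, D j (ad B C) = ad (D j B) C + ad B (D j C))
    (N : ℕ) (A : G) (S : Finset ℕ) (hS : ∀ j ∈ S, j < N) (T : Finset ℕ) (hT : insert N S = T) :
    opProd (fun j => D j - ad (X j)) S A =
      ∑ P : Finpartition T, (-1 : ℝ) ^ (P.parts.card - 1) • blockTerm ad D X N P A := by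
  induction S using Finset.induction_on_min generalizing T with
  | empty =>
    obtain rfl : ({N} : Finset ℕ) = T := hT
    let P₀ : Finpartition ({N} : Finset ℕ) :=
      Finpartition.indiscrete (Finset.singleton_ne_empty N)
    have := IsAtom.uniqueFinpartition (P := P₀) (Finset.isAtom_singleton N)
    have hparts (P : Finpartition ({N} : Finset ℕ)) : P.parts = {{N}} := by
      rw [Subsingleton.elim P P₀]
      rfl
    have hpart (P : Finpartition ({N} : Finset ℕ)) : P.part N = {N} :=
      P.part_eq_of_mem (by simp [hparts]) (Finset.mem_singleton_self N)
    have hstar (P : Finpartition ({N} : Finset ℕ)) : starMax N P = ∅ := by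
      simp [starMax, hparts, hpart]
    rw [Fintype.sum_subsingleton _ P₀,
      blockTerm, hstar, hparts, hpart]
    simp
  | insert a S haS ih =>
    have haN : a < N := hS a (Finset.mem_insert_self _ _)
    have haT : ∀ b ∈ insert N S, a < b := by
      intro b hb
      rcases Finset.mem_insert.1 hb with rfl | hb
      · exact haN
      · exact haS b hb
    have ha : a ∉ insert N S := fun h => lt_irrefl a (haT a h)
    have hN : N ∈ insert N S := Finset.mem_insert_self _ _
    obtain rfl : insert a (insert N S) = T := by rw [← hT, Finset.insert_comm]
    rw [opProd_insert_of_lt _ haS, ih (fun j hj => hS j (Finset.mem_insert_of_mem hj)) _ rfl,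
      map_sum, Finpartition.sum_insert_eq_sum_adjoin ha]
    refine Finset.sum_congr rfl fun P _ => ?_
    have hpos : P.parts.card - 1 + 1 = P.parts.card :=
      Nat.sub_add_cancel (Finset.card_pos.2 ⟨_, P.part_mem.2 hN⟩)
    rw [Finpartition.card_parts_adjoin_empty, blockTerm_adjoin_empty ad D X haT hN, map_smul,
      LinearMap.sub_apply, map_blockTerm ad D X hD haT hN (ha := ha), smul_sub, Finset.smul_sum,
      Nat.add_sub_cancel, ← hpos, pow_succ, hpos, mul_neg_one, neg_smul, sub_eq_neg_add]
    refine congrArg _ (Finset.sum_congr rfl fun q _ => ?_)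
    rw [Finpartition.card_parts_adjoin_of_mem q.2]

end Abstract

/-! ### Smooth sections of the endomorphism bundle -/

section Geometry

variable {E : Type*} [NormedAddCommGroup E] [NormedSpace ℝ E]
  {M : Type*} [TopologicalSpace M] [ChartedSpace E M] [IsManifold 𝓘(ℝ, E) ∞ M]

local notation "VF" => VField 𝓘(ℝ, E) M
local notation "EF" => EndField 𝓘(ℝ, E) M

theorem VField.Smooth.mdifferentiableAt {V : VF} (hV : V.Smooth) (x : M) : MDiffAt (T% V) x :=
  (hV x).mdifferentiableAt (by simp)

theorem EndField.Smooth.diffAt {A : EF} (hA : A.Smooth) (x : M) : A.DiffAt x :=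
  (hA x).mdifferentiableAt (by simp)

theorem EndField.Smooth.app {A : EF} (hA : A.Smooth) {V : VF} (hV : V.Smooth) :
    (A.app V).Smooth :=
  ContMDiff.clm_bundle_apply (F₁ := E) (F₂ := E)
    (E₁ := (TangentSpace 𝓘(ℝ, E) : M → Type _)) (E₂ := (TangentSpace 𝓘(ℝ, E) : M → Type _))
    (b := fun y : M => y) hA hV

theorem VField.Smooth.sub {V W : VF} (hV : V.Smooth) (hW : W.Smooth) : (V - W).Smooth :=
  ContMDiff.sub_section hV hW

theorem EndField.Smooth.zero : (0 : EF).Smooth :=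
  contMDiff_zeroSection ℝ (F := E →L[ℝ] E)
    (fun y : M => TangentSpace 𝓘(ℝ, E) y →L[ℝ] TangentSpace 𝓘(ℝ, E) y)

theorem EndField.Smooth.add {A B : EF} (hA : A.Smooth) (hB : B.Smooth) : (A + B).Smooth :=
  ContMDiff.add_section hA hB

theorem EndField.Smooth.smul (c : ℝ) {A : EF} (hA : A.Smooth) : (c • A).Smooth :=
  ContMDiff.smul_section (contMDiff_const (c := c)) hA

/-- Endomorphism fields agree if they agree on all vector fields, differentiable at the point. -/
theorem endField_eq_of_app {A B : EF}
    (h : ∀ (x : M) (V : VF), MDiffAt (T% V) x → A x (V x) = B x (V x)) : A = B := by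
  funext x
  ext v
  have := h x (FiberBundle.extend E v) (FiberBundle.mdifferentiableAt_extend _ _ v)
  simpa using this

theorem cov_sub (cov : CovariantDerivative 𝓘(ℝ, E) E (TangentSpace 𝓘(ℝ, E) : M → Type _))
    {V W : VF} {x : M} (hV : MDiffAt (T% V) x) (hW : MDiffAt (T% W) x) :
    cov (V - W) x = cov V x - cov W x := by
  have h := cov.isCovariantDerivativeOnUniv.add (mdifferentiableAt_sub_section hV hW) hW
  rw [sub_add_cancel] at h
  exact eq_sub_of_add_eq h.symm

theorem cov_smooth (cov : CovariantDerivative 𝓘(ℝ, E) E (TangentSpace 𝓘(ℝ, E) : M → Type _))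
    (hs : CovariantDerivative.ContMDiffCovariantDerivative cov ∞) {V : VF}
    (hV : V.Smooth) : EndField.Smooth (cov V) :=
  contMDiffOn_univ.1 (hs.contMDiff.contMDiff (σ := V) (contMDiffOn_univ.2 hV))

variable [FiniteDimensional ℝ E]

/-- An endomorphism of `E` depends continuously and linearly on its values on a basis. -/
theorem clm_eq_sum_smulRightL {ι : Type*} [Fintype ι] (b : Module.Basis ι ℝ E) (φ : E →L[ℝ] E) :
    φ = ∑ i, ContinuousLinearMap.smulRightL ℝ E E (LinearMap.toContinuousLinearMap (b.coord i))
      (φ (b i)) := by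
  ext v
  conv_lhs => rw [← b.sum_repr v, map_sum]
  simp

/-- A vector field that is smooth on a neighbourhood `u` of `x₀` agrees near `x₀` with a globally
smooth vector field. -/
theorem exists_smooth_eventuallyEq [T2Space M] {x₀ : M} {u : Set M} (hu : IsOpen u) (hx₀ : x₀ ∈ u)
    {W : VF} (hW : ContMDiffOn 𝓘(ℝ, E) (𝓘(ℝ, E)).tangent ∞ (T% W) u) :
    ∃ V : VF, V.Smooth ∧ ∀ᶠ x in nhds x₀, V x = W x := by
  obtain ⟨f, -, hf⟩ := (SmoothBumpFunction.nhds_basis_tsupport (I := 𝓘(ℝ, E)) x₀).mem_iff.1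
    (hu.mem_nhds hx₀)
  refine ⟨(f : M → ℝ) • W, ContMDiffOn.smul_section_of_tsupport f.contMDiff.contMDiffOn hu hf hW, ?_⟩
  filter_upwards [f.eventuallyEq_one] with x hx
  simp [hx]

/-- An endomorphism field is smooth as soon as it maps smooth vector fields to smooth vector
fields. -/
theorem EndField.smooth_of_app [T2Space M] {A : EF} (h : ∀ V : VF, V.Smooth → (A.app V).Smooth) :
    A.Smooth := by
  intro x₀
  rw [contMDiffAt_hom_bundle]
  refine ⟨contMDiffAt_id, ?_⟩
  set e := trivializationAt E (TangentSpace 𝓘(ℝ, E) : M → Type _) x₀ with he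
  have hx₀ : x₀ ∈ e.baseSet := FiberBundle.mem_baseSet_trivializationAt' x₀
  let b := Module.finBasis ℝ E
  -- In the trivialization around `x₀` the field `A` is a function to `E →L[ℝ] E`, and it suffices to
  -- treat its values on a basis, which are the coordinates of `A` applied to a local frame.
  have hi : ∀ i, ContMDiffAt 𝓘(ℝ, E) 𝓘(ℝ, E) ∞ (fun x => ContinuousLinearMap.inCoordinates E
      (TangentSpace 𝓘(ℝ, E) : M → Type _) E (TangentSpace 𝓘(ℝ, E) : M → Type _)
      x₀ x x₀ x (A x) (b i)) x₀ := by
    intro i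
    obtain ⟨V, hV, hVe⟩ := exists_smooth_eventuallyEq e.open_baseSet hx₀
      (e.contMDiffOn_localFrame_baseSet (I := 𝓘(ℝ, E)) ∞ b i)
    have h1 := (contMDiffAt_section x₀).1 ((h V hV) x₀)
    refine h1.congr_of_eventuallyEq ?_
    filter_upwards [hVe, e.open_baseSet.mem_nhds hx₀] with x hx hxe
    rw [ContinuousLinearMap.inCoordinates_eq hxe hxe]
    simp only [EndField.app, hx, ← he]
    simp [Trivialization.localFrame_apply_of_mem_baseSet, hxe, Trivialization.basisAt]
  have hsum : (fun x => ContinuousLinearMap.inCoordinates E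
      (TangentSpace 𝓘(ℝ, E) : M → Type _) E (TangentSpace 𝓘(ℝ, E) : M → Type _)
      x₀ x x₀ x (A x)) = fun x => ∑ i, ContinuousLinearMap.smulRightL ℝ E E
        (LinearMap.toContinuousLinearMap (b.coord i)) (ContinuousLinearMap.inCoordinates E
      (TangentSpace 𝓘(ℝ, E) : M → Type _) E (TangentSpace 𝓘(ℝ, E) : M → Type _)
      x₀ x x₀ x (A x) (b i)) :=
    funext fun x => clm_eq_sum_smulRightL b _
  show ContMDiffAt 𝓘(ℝ, E) 𝓘(ℝ, E →L[ℝ] E) ∞ (fun x => ContinuousLinearMap.inCoordinates E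
      (TangentSpace 𝓘(ℝ, E) : M → Type _) E (TangentSpace 𝓘(ℝ, E) : M → Type _)
      x₀ x x₀ x (A x)) x₀
  rw [hsum]
  refine contMDiffAt_finsetSum fun i _ => ?_
  exact (ContinuousLinearMap.contMDiff _).contMDiffAt.comp x₀ (hi i)

theorem EndField.Smooth.adEnd [T2Space M] {A B : EF} (hB : B.Smooth) (hA : A.Smooth) :
    (adEnd B A).Smooth :=
  EndField.smooth_of_app fun _ hV => (hB.app (hA.app hV)).sub (hA.app (hB.app hV))

/-! ### Connections and endomorphism fields -/

variable (cov : CovariantDerivative 𝓘(ℝ, E) E (TangentSpace 𝓘(ℝ, E) : M → Type _))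

theorem covEnd_app (ξ : VF) {A : EF} {x : M} (hA : A.DiffAt x) {V : VF} (hV : MDiffAt (T% V) x) :
    covEnd cov ξ A x (V x) = cov (A.app V) x (ξ x) - A x (cov V x (ξ x)) :=
  covEnd_apply cov ξ hA hV

theorem app_covEnd (ξ : VF) {A : EF} (hA : A.Smooth) {V : VF} (hV : V.Smooth) :
    (covEnd cov ξ A).app V =
      EndField.app (cov (A.app V)) ξ - A.app (EndField.app (cov V) ξ) := by
  funext x
  exact covEnd_apply cov ξ (hA.diffAt x) (hV.mdifferentiableAt x)

theorem EndField.Smooth.covEnd [T2Space M]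
    (hs : CovariantDerivative.ContMDiffCovariantDerivative cov ∞) {ξ : VF} (hξ : ξ.Smooth)
    {A : EF} (hA : A.Smooth) : (covEnd cov ξ A).Smooth :=
  EndField.smooth_of_app fun V hV => by
    rw [app_covEnd cov ξ hA hV]
    exact ((cov_smooth cov hs (hA.app hV)).app hξ).sub (hA.app ((cov_smooth cov hs hV).app hξ))

theorem covEnd_add (ξ : VF) {A B : EF} (hA : A.Smooth) (hB : B.Smooth) :
    covEnd cov ξ (A + B) = covEnd cov ξ A + covEnd cov ξ B := by
  refine endField_eq_of_app fun x V hV => ?_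
  have h := cov.isCovariantDerivativeOnUniv.add ((hA.diffAt x).app hV) ((hB.diffAt x).app hV)
  have happ : (A + B).app V = A.app V + B.app V := rfl
  rw [Pi.add_apply, add_apply, covEnd_app cov ξ ((hA.add hB).diffAt x) hV,
    covEnd_app cov ξ (hA.diffAt x) hV, covEnd_app cov ξ (hB.diffAt x) hV, happ, h]
  simp only [add_apply, Pi.add_apply]
  abel

theorem covEnd_smul (ξ : VF) (c : ℝ) {A : EF} (hA : A.Smooth) :
    covEnd cov ξ (c • A) = c • covEnd cov ξ A := by
  refine endField_eq_of_app fun x V hV => ?_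
  have h := cov.isCovariantDerivativeOnUniv.smul_const c ((hA.diffAt x).app hV)
  have happ : (c • A).app V = c • A.app V := rfl
  rw [Pi.smul_apply, smul_apply, covEnd_app cov ξ ((hA.smul c).diffAt x) hV,
    covEnd_app cov ξ (hA.diffAt x) hV, happ, h, smul_sub]
  rfl

/-- `∇_ξ` is a derivation of the commutator of endomorphism fields. -/
theorem covEnd_adEnd [T2Space M] (ξ : VF) {A B : EF} (hB : B.Smooth) (hA : A.Smooth) :
    covEnd cov ξ (adEnd B A) = adEnd (covEnd cov ξ B) A + adEnd B (covEnd cov ξ A) := by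
  refine endField_eq_of_app fun x V hV => ?_
  have hAV := (hA.diffAt x).app hV
  have hBV := (hB.diffAt x).app hV
  have hsub : cov ((adEnd B A).app V) x = cov (B.app (A.app V)) x - cov (A.app (B.app V)) x :=
    cov_sub cov ((hB.diffAt x).app hAV) ((hA.diffAt x).app hBV)
  have hright : (adEnd (covEnd cov ξ B) A + adEnd B (covEnd cov ξ A)) x (V x) =
      (covEnd cov ξ B x (A.app V x) - A x (covEnd cov ξ B x (V x))) +
        (B x (covEnd cov ξ A x (V x)) - covEnd cov ξ A x (B.app V x)) := rfl
  have hleft : adEnd B A x (cov V x (ξ x)) =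
      B x (A x (cov V x (ξ x))) - A x (B x (cov V x (ξ x))) := rfl
  rw [hright, covEnd_app cov ξ ((hB.adEnd hA).diffAt x) hV, covEnd_app cov ξ (hA.diffAt x) hV,
    covEnd_app cov ξ (hB.diffAt x) hV, covEnd_app cov ξ (hA.diffAt x) hBV,
    covEnd_app cov ξ (hB.diffAt x) hAV, map_sub, map_sub, hleft, hsub, sub_apply]
  abel

/-- For a torsion-free connection, `L_ξ = ∇_ξ - ad(∇ξ)` on endomorphism fields. -/
theorem lieEnd_eq_covEnd_sub_adEnd (htorsion : cov.torsion = 0) {ξ : VF} (hξ : ξ.Smooth) {A : EF}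
    (hA : A.Smooth) : lieEnd ξ A = covEnd cov ξ A - adEnd (cov ξ) A := by
  refine endField_eq_of_app fun x V hV => ?_
  have ht {W : VF} (hW : MDiffAt (T% W) x) :
      VectorField.mlieBracket 𝓘(ℝ, E) ξ W x = cov W x (ξ x) - cov ξ x (W x) :=
    (cov.torsion_eq_zero_iff.1 htorsion (hξ.mdifferentiableAt x) hW).symm
  have hleft : lieEnd ξ A x (V x) = VectorField.mlieBracket 𝓘(ℝ, E) ξ (A.app V) x
      - A x (VectorField.mlieBracket 𝓘(ℝ, E) ξ V x) := lieEnd_apply ξ (hA.diffAt x) hV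
  have hright : (covEnd cov ξ A - adEnd (cov ξ) A) x (V x) =
      covEnd cov ξ A x (V x) - (cov ξ x (A.app V x) - A x (cov ξ x (V x))) := rfl
  rw [hleft, hright, covEnd_app cov ξ (hA.diffAt x) hV, ht hV, ht ((hA.diffAt x).app hV), map_sub]
  abel

/-! ### The operators on the space of smooth endomorphism fields -/

variable (E M) in
/-- The vector space of smooth sections of `End(TM)`. -/
def smoothEnd : Submodule ℝ EF where
  carrier := {A | A.Smooth}
  zero_mem' := EndField.Smooth.zero
  add_mem' hA hB := hA.add hB
  smul_mem' c _ hA := hA.smul c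

/-- The commutator of smooth endomorphism fields, as a bilinear map. -/
def adLin [T2Space M] : smoothEnd E M →ₗ[ℝ] smoothEnd E M →ₗ[ℝ] smoothEnd E M :=
  LinearMap.mk₂ ℝ (fun B A => ⟨adEnd B.1 A.1, B.2.adEnd A.2⟩)
    (fun B B' A => by
      ext x v
      simp only [adEnd, Submodule.coe_add, Pi.add_apply, ContinuousLinearMap.add_comp,
        ContinuousLinearMap.comp_add]
      abel_nf)
    (fun c B A => by
      ext x v
      simp [adEnd, smul_sub])
    (fun B A A' => by
      ext x v
      simp only [adEnd, Submodule.coe_add, Pi.add_apply, ContinuousLinearMap.add_comp,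
        ContinuousLinearMap.comp_add]
      abel_nf)
    (fun c B A => by
      ext x v
      simp [adEnd, smul_sub])

/-- The operator `∇_ξ` on smooth endomorphism fields, for a smooth vector field `ξ`. -/
def covLin [T2Space M] (hs : CovariantDerivative.ContMDiffCovariantDerivative cov ∞) {ξ : VF}
    (hξ : ξ.Smooth) : smoothEnd E M →ₗ[ℝ] smoothEnd E M where
  toFun A := ⟨covEnd cov ξ A.1, A.2.covEnd cov hs hξ⟩
  map_add' A B := Subtype.ext (covEnd_add cov ξ A.2 B.2)
  map_smul' c A := Subtype.ext (covEnd_smul cov ξ c A.2)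

/-- The partition formula when all the vector fields are smooth, also those whose index does not
occur in the product. -/
theorem opProd_lieEnd_eq_sum [T2Space M]
    (hs : CovariantDerivative.ContMDiffCovariantDerivative cov ∞) (htorsion : cov.torsion = 0)
    (k : ℕ) {ξ : ℕ → VF} (hξ : ∀ j, (ξ j).Smooth) {A : EF} (hA : A.Smooth) :
    opProd (fun j => lieEnd (ξ j)) (Finset.Icc 1 k) A =
      ∑ P : Finpartition (Finset.Icc 1 (k + 1)),
        (-1 : ℝ) ^ (P.parts.card - 1) • partTerm cov ξ P A := by
  let D : ℕ → smoothEnd E M →ₗ[ℝ] smoothEnd E M := fun j => covLin cov hs (hξ j)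
  let X : ℕ → smoothEnd E M := fun j => ⟨cov (ξ j), cov_smooth cov hs (hξ j)⟩
  have hD : ∀ j B C, D j (adLin B C) = adLin (D j B) C + adLin B (D j C) := fun j B C =>
    Subtype.ext (covEnd_adEnd cov (ξ j) B.2 C.2)
  have hIcc : insert (k + 1) (Finset.Icc 1 k) = Finset.Icc 1 (k + 1) :=
    Finset.insert_Icc_right_eq_Icc_add_one (by omega)
  have hcov (S : Finset ℕ) (B : smoothEnd E M) :
      ((opProd (fun j => D j) S B : smoothEnd E M) : EF) = covProd cov ξ S B :=
    map_opProd (Subtype.val : smoothEnd E M → EF) (fun _ _ _ => rfl) B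
  have hterm (P : Finpartition (Finset.Icc 1 (k + 1))) :
      ((blockTerm adLin D X (k + 1) P ⟨A, hA⟩ : smoothEnd E M) : EF) = partTerm cov ξ P A := by
    rw [blockTerm, partTerm, map_opProd (Subtype.val : smoothEnd E M → EF)
      (T' := fun m => adEnd (covProd cov ξ ((P.part m).erase m) (cov (ξ m)))), hcov]
    · rfl
    · intro m _ B
      rw [← hcov _ (X m)]
      rfl
  have h := congrArg (Subtype.val : smoothEnd E M → EF)
    (opProd_sub_ad_eq_sum adLin D X hD (k + 1) ⟨A, hA⟩ (Finset.Icc 1 k)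
      (fun j hj => Nat.lt_succ_of_le (Finset.mem_Icc.1 hj).2) _ hIcc)
  rw [map_opProd (Subtype.val : smoothEnd E M → EF) (T' := fun j => lieEnd (ξ j))] at h
  · rw [h, Submodule.coe_sum]
    refine Finset.sum_congr rfl fun P _ => ?_
    rw [← hterm]
    rfl
  · intro j _ B
    exact (lieEnd_eq_covEnd_sub_adEnd cov htorsion (hξ j) B.2).symm

end Geometry
end MultLie

end

theorem mainTheorem4
    {E : Type*} [NormedAddCommGroup E] [NormedSpace ℝ E] [FiniteDimensional ℝ E]
    {M : Type*} [TopologicalSpace M] [T2Space M] [ChartedSpace E M] [IsManifold 𝓘(ℝ, E) ∞ M]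
    (cov : CovariantDerivative 𝓘(ℝ, E) E (TangentSpace 𝓘(ℝ, E) : M → Type _))
    (hsmooth : CovariantDerivative.ContMDiffCovariantDerivative cov ∞)
    (htorsion : cov.torsion = 0)
    (k : ℕ) (ξ : ℕ → MultLie.VField 𝓘(ℝ, E) M)
    (hξ : ∀ j ∈ Finset.Icc 1 k, MultLie.VField.Smooth (ξ j))
    (A : MultLie.EndField 𝓘(ℝ, E) M) (hA : MultLie.EndField.Smooth A) :
    MultLie.opProd (fun j => MultLie.lieEnd (ξ j)) (Finset.Icc 1 k) A =
      ∑ P : Finpartition (Finset.Icc 1 (k + 1)),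
        (-1 : ℝ) ^ (P.parts.card - 1) • MultLie.partTerm cov ξ P A := by
  classical
  -- Only the fields with index in `{1, …, k}` are known to be smooth and only these occur in the
  -- formula; the others are replaced by `0`.
  let η : ℕ → MultLie.VField 𝓘(ℝ, E) M := fun j => if j ∈ Finset.Icc 1 k then ξ j else 0
  have hη_eq : ∀ j ∈ Finset.Icc 1 k, η j = ξ j := fun j hj => if_pos hj
  have hη : ∀ j, MultLie.VField.Smooth (η j) := by
    intro j
    by_cases hj : j ∈ Finset.Icc 1 k
    · rw [hη_eq j hj]
      exact hξ j hj
    · simp only [η, if_neg hj]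
      exact contMDiff_zeroSection ℝ (TangentSpace 𝓘(ℝ, E) : M → Type _)
  have hcov (S : Finset ℕ) (hS : S ⊆ Finset.Icc 1 k) (B : MultLie.EndField 𝓘(ℝ, E) M) :
      MultLie.covProd cov η S B = MultLie.covProd cov ξ S B :=
    MultLie.opProd_congr (fun j hj => by rw [hη_eq j (hS hj)]) B
  have hlie : MultLie.opProd (fun j => MultLie.lieEnd (η j)) (Finset.Icc 1 k) A =
      MultLie.opProd (fun j => MultLie.lieEnd (ξ j)) (Finset.Icc 1 k) A :=
    MultLie.opProd_congr (fun j hj => by rw [hη_eq j hj]) A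
  have hIcc : (Finset.Icc 1 (k + 1)).erase (k + 1) = Finset.Icc 1 k := by
    ext j
    simp only [Finset.mem_erase, Finset.mem_Icc]
    omega
  rw [← hlie, MultLie.opProd_lieEnd_eq_sum cov hsmooth htorsion k hη hA]
  refine Finset.sum_congr rfl fun P _ => congrArg _ ?_
  rw [MultLie.partTerm, MultLie.partTerm,
    hcov _ (hIcc ▸ Finset.erase_subset_erase _ (P.part_subset _))]
  refine MultLie.opProd_congr (fun m hm => ?_) _
  obtain ⟨p, hp, rfl⟩ := Finset.mem_image.1 hm
  have hpP : p ∈ P.parts := Finset.mem_of_mem_erase hp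
  have hmem := MultLie.maxOf_mem (P.nonempty_of_mem_parts hpP)
  have hmax : MultLie.maxOf p ∈ Finset.Icc 1 k :=
    hIcc ▸ MultLie.starMax_subset P (show MultLie.maxOf p ∈ MultLie.starMax (k + 1) P from hm)
  have hsub : (P.part (MultLie.maxOf p)).erase (MultLie.maxOf p) ⊆ Finset.Icc 1 k := by
    intro j hj
    rw [MultLie.part_maxOf P hpP] at hj
    have hj1 := (Finset.mem_Icc.1 (P.subset hpP (Finset.mem_of_mem_erase hj))).1
    have hj2 := MultLie.le_maxOf (Finset.mem_of_mem_erase hj)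
    exact Finset.mem_Icc.2 ⟨hj1, hj2.trans (Finset.mem_Icc.1 hmax).2⟩
  rw [hcov _ hsub, hη_eq _ hmax]
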